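/- Let $\mathcal A$ be a finite alphabet, let $A$ be a $0$--$1$ matrix indexed by $\mathcal A$, and let $\Sigma_A=\{x\in\mathcal A^{\mathbb Z}: A_{x_ix_{i+1}}=1\ \forall i\in\mathbb Z\}$ be the associated two-sided Markov shift, assumed non-empty, with shift map $\sigma$, $\sigma(x)_i=x_{i+1}$. A binary operation $\star$ on a set is called a quasigroup operation if it is left and right cancellable ($a\star b=a\star c\Leftrightarrow b=c$ and $b\star a=c\star a\Leftrightarrow b=c$). A binary operation $\star$ on a shift space $\Lambda$ is called an $(\ell+r+1)$-block operation with memory $\ell$ and anticipation $r$ if there is a local rule $\rho$ such that $(x\star y)_j=\rho(x_{j-\ell}\cdots x_{j+r},\,y_{j-\ell}\cdots y_{j+r})$ for all $x,y\in\Lambda$ and $j\in\mathbb Z$; a $1$-block operation is the case $\ell=r=0$. Let $*$ be a $1$-block quasigroup operation on $\Sigma_A$. Then there are a finite shift space $\mathbb F$ (over a finite alphabet) with a $1$-block quasigroup operation, a full $n$-shift $\Sigma_n=\{1,\dots,n\}^{\mathbb Z}$, and a quasigroup operation $\otimes$ on $\mathbb F\times\Sigma_n$ (viewed as a shift space over the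 product alphabet) for which the projection to the quasigroup $\mathbb F$ is a homomorphism, such that: 1. $\otimes$ is a $k$-block operation with memory $k-1$ and anticipation $0$ for some $k\ge 1$, and $(\Sigma_A,*,\sigma)$ is isomorphic to $(\mathbb F\times\Sigma_n,\otimes,\sigma_{\mathbb F}\times\sigma_{\Sigma_n})$ by a $1$-block code, that is, there is a homeomorphism $\zeta:\Sigma_A\to\mathbb F\times\Sigma_n$ which commutes with the shift maps, satisfies $\zeta(x*y)=\zeta(x)\otimes\zeta(y)$, and is of the form $\zeta(x)_j=f(x_j)$ for a map $f$ of the alphabets. 2. The topological entropy of $(\Sigma_A,\sigma)$ is $0$ if and only if $\Sigma_n$ consists of a single constant sequence. 3. $\Sigma_A$ is irreducible (some point has a dense forward orbit under $\sigma$) and contains a constant sequence if and only if $\mathbb F$ consists of a single point. -/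

import Mathlib

universe u

namespace QuasigroupShift

/-- The shift map on the full shift `A^ℤ`. -/
def shift {A : Type*} (x : ℤ → A) : ℤ → A := fun i => x (i + 1)

/-- A two-sided shift space over the alphabet `A`: a closed subset `Λ` of `A^ℤ` which is
invariant under the shift (`σ(Λ) = Λ`; as the shift of `A^ℤ` is bijective, this says that
`σ(x) ∈ Λ ↔ x ∈ Λ`). -/
structure ShiftSpace (A : Type*) [TopologicalSpace A] where
  carrier : Set (ℤ → A)
  isClosed : IsClosed carrier
  shift_mem_iff : ∀ x : ℤ → A, shift x ∈ carrier ↔ x ∈ carrier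

/-- The points of a shift space, as a type, with the topology (uniformity) induced from the
product topology (uniformity) of `A^ℤ`. -/
abbrev ShiftSpace.Pt {A : Type*} [TopologicalSpace A] (Λ : ShiftSpace A) : Type _ :=
  {x : ℤ → A // x ∈ Λ.carrier}

/-- The shift map `σ_Λ` of a shift space `Λ`. -/
def ShiftSpace.shiftMap {A : Type*} [TopologicalSpace A] (Λ : ShiftSpace A) (x : Λ.Pt) : Λ.Pt :=
  ⟨shift x.1, (Λ.shift_mem_iff x.1).2 x.2⟩

/-- The two-sided Markov shift `{x | M (x i) (x (i+1)) = 1 for all i}` of a transition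
matrix `M`. -/
def markovShift {A : Type*} [TopologicalSpace A] [DiscreteTopology A] (M : Matrix A A ℕ) :
    ShiftSpace A where
  carrier := {x | ∀ i : ℤ, M (x i) (x (i + 1)) = 1}
  isClosed := by
    rw [Set.ofPred_forall]
    refine isClosed_iInter fun i => ?_
    have hc : Continuous fun x : ℤ → A => (x i, x (i + 1)) := by fun_prop
    exact (isClosed_discrete {p : A × A | M p.1 p.2 = 1}).preimage hc
  shift_mem_iff := by
    intro x
    constructor
    · intro h i
      have := h (i - 1)
      simpa [shift] using this
    · intro h i
      exact h (i + 1)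

/-- The full `n`-shift. -/
def fullShift (n : ℕ) : ShiftSpace (Fin n) where
  carrier := Set.univ
  isClosed := isClosed_univ
  shift_mem_iff := fun _ => Iff.rfl

/-- The product `Λ × Γ` of two shift spaces with the shift map `σ_Λ × σ_Γ`, where the pair
`((x_i), (y_i))` is written as the sequence `(x_i, y_i)` over the product alphabet. -/
def ShiftSpace.prod {A B : Type*} [TopologicalSpace A] [TopologicalSpace B]
    (Λ : ShiftSpace A) (Γ : ShiftSpace B) : ShiftSpace (A × B) where
  carrier := {z | (fun i => (z i).1) ∈ Λ.carrier ∧ (fun i => (z i).2) ∈ Γ.carrier}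
  isClosed := by
    have h1 : Continuous fun (z : ℤ → A × B) (i : ℤ) => (z i).1 := by fun_prop
    have h2 : Continuous fun (z : ℤ → A × B) (i : ℤ) => (z i).2 := by fun_prop
    exact (Λ.isClosed.preimage h1).inter (Γ.isClosed.preimage h2)
  shift_mem_iff := fun z =>
    and_congr (Λ.shift_mem_iff fun i => (z i).1) (Γ.shift_mem_iff fun i => (z i).2)

/-- The projection of a product of shift spaces to its first factor. -/
def ShiftSpace.fst {A B : Type*} [TopologicalSpace A] [TopologicalSpace B]
    {Λ : ShiftSpace A} {Γ : ShiftSpace B} (z : (Λ.prod Γ).Pt) : Λ.Pt :=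
  ⟨fun i => (z.1 i).1, z.2.1⟩

/-- A binary operation is a quasigroup operation if it is left and right cancellable. -/
def IsQuasigroup {X : Type*} (op : X → X → X) : Prop :=
  (∀ a b c : X, op a b = op a c ↔ b = c) ∧ (∀ a b c : X, op b a = op c a ↔ b = c)

/-- The word `x[j - l, j + r]` of length `l + r + 1`. -/
def window {A : Type*} (l r : ℕ) (x : ℤ → A) (j : ℤ) : Fin (l + r + 1) → A :=
  fun i => x (j - (l : ℤ) + ((i : ℕ) : ℤ))

/-- The operation `op` on the shift space `Λ` is an `(l + r + 1)`-block operation with memory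
`l` and anticipation `r`: it is given by a local rule on pairs of words of length
`l + r + 1`. -/
def IsBlockOp {A : Type*} [TopologicalSpace A] {Λ : ShiftSpace A} (l r : ℕ)
    (op : Λ.Pt → Λ.Pt → Λ.Pt) : Prop :=
  ∃ ρ : (Fin (l + r + 1) → A) → (Fin (l + r + 1) → A) → A,
    ∀ (x y : Λ.Pt) (j : ℤ), (op x y).1 j = ρ (window l r x.1 j) (window l r y.1 j)

/-- A `1`-block operation has memory `0` and anticipation `0`. -/
def IsOneBlockOp {A : Type*} [TopologicalSpace A] {Λ : ShiftSpace A}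
    (op : Λ.Pt → Λ.Pt → Λ.Pt) : Prop :=
  IsBlockOp 0 0 op

/-- A map between shift spaces is a `1`-block code if it is given coordinatewise by a map of
the alphabets. -/
def IsOneBlockCode {A B : Type*} [TopologicalSpace A] [TopologicalSpace B]
    {Λ : ShiftSpace A} {Γ : ShiftSpace B} (ζ : Λ.Pt → Γ.Pt) : Prop :=
  ∃ f : A → B, ∀ (x : Λ.Pt) (j : ℤ), (ζ x).1 j = f (x.1 j)

/-- The homeomorphism `ζ` is an isomorphism from `(Λ, op, σ_Λ)` to `(Γ, op', σ_Γ)`: a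
topological conjugacy of the shift maps which is also an isomorphism of the operations. -/
def IsIsomorphism {A B : Type*} [TopologicalSpace A] [TopologicalSpace B]
    {Λ : ShiftSpace A} {Γ : ShiftSpace B} (op : Λ.Pt → Λ.Pt → Λ.Pt)
    (op' : Γ.Pt → Γ.Pt → Γ.Pt) (ζ : Λ.Pt ≃ₜ Γ.Pt) : Prop :=
  (∀ x, ζ (Λ.shiftMap x) = Γ.shiftMap (ζ x)) ∧ (∀ x y, ζ (op x y) = op' (ζ x) (ζ y))

/-- A shift space is irreducible (transitive) if some point has a dense forward orbit. -/
def ShiftSpace.IsIrreducible {A : Type*} [TopologicalSpace A] (Λ : ShiftSpace A) : Prop :=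
  ∃ x : Λ.Pt, Dense (Set.range fun n : ℕ => Λ.shiftMap^[n] x)

/-- The shift space contains a constant sequence. -/
def ShiftSpace.HasConstantSequence {A : Type*} [TopologicalSpace A] (Λ : ShiftSpace A) : Prop :=
  ∃ a : A, (fun _ : ℤ => a) ∈ Λ.carrier

/-- The topological entropy of the system `(Λ, σ_Λ)`. -/
noncomputable def ShiftSpace.entropy {A : Type*} [UniformSpace A] (Λ : ShiftSpace A) : EReal :=
  Dynamics.coverEntropy Λ.shiftMap (Set.univ : Set Λ.Pt)

end QuasigroupShift

/-! The points of the Markov shift are the bi-infinite paths in the finite graph of letters that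
occur, and the operation acts letterwise. Three facts carry the proof.

Cancellation descends from points to letters (`injective_of_path_cancel`). Periodic points of a
given period form a finite quasigroup, so the letters on closed walks of a common length `p` do too.
On them, reachability in a multiple of `p` steps is a compatible preorder, hence symmetric; a letter
lying between two of them is then itself on a closed walk, and every letter is of this kind.

In such a quasigroup graph, follower sets are equal or disjoint (`followSetoid_of_common`), and
having the same followers is a congruence whose quotient is again a quasigroup graph. A path amounts
to its quotient path together with a free choice, at each time, inside a class of the congruence
"same followers and same predecessors". These classes all have the same size `d`, so each quotient
step splits off a full `d`-shift at the cost of one more unit of memory in decoding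
(`exists_pathCode_of_quotient`).

The quotients shrink until the graph is that of a permutation `τ`, whose orbits form the finite
factor. The entropy comes from the free labels only. A dense orbit through a fixed point of `τ`
forces `τ` to live on a single point; conversely, if it does, only free labels remain. -/

namespace QuasigroupShift

/-! ### Paths and walks in a finite graph; cancellation on letters -/

section Walks

variable {E : Type*}

/-- A bi-infinite path in the directed graph `T`. -/
def IsPath (T : E → E → Prop) (x : ℤ → E) : Prop := ∀ i, T (x i) (x (i + 1))

lemma IsPath.shift_add {T : E → E → Prop} {x : ℤ → E} (hx : IsPath T x) (k : ℤ) :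
    IsPath T fun i => x (i + k) := by
  intro i
  have := hx (i + k)
  rwa [add_right_comm] at this

lemma IsPath.op {T : E → E → Prop} {op : E → E → E}
    (hop : ∀ {a b c d}, T a b → T c d → T (op a c) (op b d)) {x y : ℤ → E}
    (hx : IsPath T x) (hy : IsPath T y) : IsPath T fun i => op (x i) (y i) :=
  fun i => hop (hx i) (hy i)

lemma IsPath.glue {T : E → E → Prop} {x y : ℤ → E} (hx : IsPath T x) (hy : IsPath T y) {k : ℤ}
    (h : T (x k) (y 1)) : IsPath T fun i => if i ≤ k then x i else y (i - k) := by
  intro i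
  rcases lt_trichotomy i k with hi | rfl | hi
  · simpa [hi.le, Int.add_one_le_iff.2 hi] using hx i
  · simpa using h
  · have h1 : ¬ i ≤ k := by omega
    have h2 : ¬ i + 1 ≤ k := by omega
    have := hy (i - k)
    simp only [h1, h2, if_false]
    rwa [show i + 1 - k = i - k + 1 by ring]

/-- There is a bi-infinite path which passes from `a` to `b` in `k` steps. -/
def Walk (T : E → E → Prop) (k : ℕ) (a b : E) : Prop := ∃ x, IsPath T x ∧ x 0 = a ∧ x k = b

lemma IsPath.walk {T : E → E → Prop} {x : ℤ → E} (hx : IsPath T x) (i : ℤ) (k : ℕ) :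
    Walk T k (x i) (x (i + k)) :=
  ⟨_, hx.shift_add i, by simp, by simp [add_comm]⟩

lemma Walk.trans {T : E → E → Prop} {k l : ℕ} {a b c : E} (h : Walk T k a b) (h' : Walk T l b c) :
    Walk T (k + l) a c := by
  obtain ⟨x, hx, rfl, rfl⟩ := h
  obtain ⟨y, hy, hxy, rfl⟩ := h'
  refine ⟨_, hx.glue hy (hxy ▸ hy 0), by simp, ?_⟩
  rcases Nat.eq_zero_or_pos l with rfl | hl
  · simp [hxy]
  · have : ¬ ((k + l : ℕ) : ℤ) ≤ k := by push_cast; omega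
    simp only [this, if_false]
    congr 1
    push_cast
    ring

lemma Walk.op {T : E → E → Prop} {op : E → E → E}
    (hop : ∀ {a b c d}, T a b → T c d → T (op a c) (op b d)) {k : ℕ} {a b c d : E}
    (h : Walk T k a b) (h' : Walk T k c d) : Walk T k (op a c) (op b d) := by
  obtain ⟨x, hx, rfl, rfl⟩ := h
  obtain ⟨y, hy, rfl, rfl⟩ := h'
  exact ⟨_, IsPath.op hop hx hy, rfl, rfl⟩

lemma Walk.iterate {T : E → E → Prop} {k : ℕ} {a : E} (h : Walk T k a a) (t : ℕ) :
    Walk T (k * t) a a := by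
  induction t with
  | zero =>
    obtain ⟨x, hx, h0, -⟩ := h
    exact ⟨x, hx, h0, by simpa using h0⟩
  | succ t ih => exact ih.trans h

/-- The periodic paths of period `p`. -/
def PeriodicPath (T : E → E → Prop) (p : ℕ) : Type _ :=
  {x : ℤ → E // IsPath T x ∧ Function.Periodic x (p : ℤ)}

lemma periodic_apply_emod {x : ℤ → E} {p : ℕ} (hx : Function.Periodic x (p : ℤ)) (i : ℤ) :
    x (i % p) = x i := by
  rw [Int.emod_def, mul_comm]
  exact hx.sub_int_mul_eq (i / p)

lemma finite_periodicPath [Finite E] (T : E → E → Prop) {p : ℕ} (hp : 0 < p) :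
    Finite (PeriodicPath T p) := by
  refine Finite.of_injective (fun x : PeriodicPath T p => fun i : Fin p => x.1 ((i : ℕ) : ℤ)) ?_
  intro x y h
  refine Subtype.ext (funext fun i => ?_)
  have hp' : (0 : ℤ) < p := by exact_mod_cast hp
  have h0 := Int.emod_nonneg i hp'.ne'
  have h1 := Int.emod_lt_of_pos i hp'
  have := congrFun h ⟨(i % p).toNat, by omega⟩
  simp only [Int.toNat_of_nonneg h0] at this
  rwa [periodic_apply_emod x.2.2, periodic_apply_emod y.2.2] at this

lemma Walk.exists_periodicPath {T : E → E → Prop} {p : ℕ} (hp : 0 < p) {a : E}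
    (h : Walk T p a a) : ∃ x : PeriodicPath T p, x.1 0 = a := by
  obtain ⟨x, hx, rfl, hxp⟩ := h
  have hp' : (0 : ℤ) < p := by exact_mod_cast hp
  refine ⟨⟨fun i => x (i % p), fun i => ?_, fun i => by simp⟩, by simp⟩
  have h0 := Int.emod_nonneg i hp'.ne'
  have h1 := Int.emod_lt_of_pos i hp'
  have key : x ((i + 1) % p) = x (i % p + 1) := by
    rw [← Int.emod_add_emod]
    rcases eq_or_lt_of_le (Int.add_one_le_iff.2 h1) with h2 | h2
    · rw [h2, Int.emod_self, hxp]
    · rw [Int.emod_eq_of_lt (by omega) h2]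
  show T (x (i % p)) (x ((i + 1) % p))
  rw [key]
  exact hx _

/-- A quasigroup operation on bi-infinite paths lets one solve `x * y = z` among periodic paths. -/
lemma PeriodicPath.exists_op_eq [Finite E] {T : E → E → Prop} {op : E → E → E}
    (hop : ∀ {a b c d}, T a b → T c d → T (op a c) (op b d))
    (hl : ∀ x y z : ℤ → E, IsPath T x → IsPath T y → IsPath T z →
      (∀ i, op (x i) (y i) = op (x i) (z i)) → y = z) {p : ℕ} (hp : 0 < p)
    (x z : PeriodicPath T p) : ∃ y : PeriodicPath T p, ∀ i, op (x.1 i) (y.1 i) = z.1 i := by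
  have := finite_periodicPath T hp
  let f : PeriodicPath T p → PeriodicPath T p := fun y =>
    ⟨fun i => op (x.1 i) (y.1 i), IsPath.op hop x.2.1 y.2.1, fun i => by
      simp only [x.2.2 i, y.2.2 i]⟩
  -- Left multiplication by `x` is an injective self-map of a finite set, hence onto.
  have hf : Function.Injective f := fun y y' h =>
    Subtype.ext (hl _ _ _ x.2.1 y.2.1 y'.2.1 fun i => congrFun (congrArg Subtype.val h) i)
  obtain ⟨y, hy⟩ := Finite.surjective_of_injective hf z
  exact ⟨y, fun i => congrFun (congrArg Subtype.val hy) i⟩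

/-- A compatible preorder on a finite quasigroup is symmetric. -/
lemma symm_of_compatible {R : Type*} [Finite R] {r : R → R → Prop} (refl : ∀ a, r a a)
    (trans : ∀ {a b c}, r a b → r b c → r a c) {op : R → R → R}
    (hop : ∀ {a b} c, r a b → r (op a c) (op b c))
    (hl : ∀ a b, ∃ c, op a c = b) (hr : ∀ c, Function.Injective fun a => op a c)
    {a b : R} (hab : r a b) : r b a := by
  -- Right translation by `c` sends the down-set of `a` injectively into that of `op a c`, which is
  -- arbitrary. So all down-sets have the same size, and an inclusion between two of them is an
  -- equality.
  have le : ∀ a b, {c | r c a}.ncard ≤ {c | r c b}.ncard := by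
    intro a b
    obtain ⟨c, rfl⟩ := hl a b
    exact Set.ncard_le_ncard_of_injOn (fun x => op x c) (fun x hx => hop c hx)
      (hr c).injOn
  have hsub : {c | r c a} ⊆ {c | r c b} := fun c hc => trans hc hab
  have := Set.eq_of_subset_of_ncard_le hsub (le b a)
  have hb : b ∈ {c | r c b} := refl b
  rwa [← this] at hb

/-- Closed walks can be repeated, so the product over all letters of one closed-walk length each
(`1` where there is none) serves every letter at once. -/
lemma exists_common_period [Finite E] (T : E → E → Prop) :
    ∃ p : ℕ, 0 < p ∧ ∀ a k, 0 < k → Walk T k a a → Walk T p a a := by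
  classical
  have := Fintype.ofFinite E
  have h : ∀ a, ∃ q : ℕ, 0 < q ∧ ∀ k, 0 < k → Walk T k a a → Walk T q a a := by
    intro a
    by_cases ha : ∃ k, 0 < k ∧ Walk T k a a
    · obtain ⟨k, hk, hw⟩ := ha
      exact ⟨k, hk, fun _ _ _ => hw⟩
    · exact ⟨1, one_pos, fun k hk hw => (ha ⟨k, hk, hw⟩).elim⟩
  choose q hq hw using h
  refine ⟨∏ a, q a, Finset.prod_pos fun a _ => hq a, fun a k hk h => ?_⟩
  obtain ⟨t, ht⟩ := Finset.dvd_prod_of_mem q (Finset.mem_univ a)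
  rw [ht]
  exact (hw a k hk h).iterate t

/-- If a compatible operation on the letters of a finite graph is cancellable on bi-infinite
paths, then it is cancellable on the letters. -/
theorem injective_of_path_cancel [Finite E] {T : E → E → Prop} (hE : ∀ a, ∃ x, IsPath T x ∧ x 0 = a)
    {op : E → E → E} (hop : ∀ {a b c d}, T a b → T c d → T (op a c) (op b d))
    (hl : ∀ x y z : ℤ → E, IsPath T x → IsPath T y → IsPath T z →
      (∀ i, op (x i) (y i) = op (x i) (z i)) → y = z)
    (hr : ∀ x y z : ℤ → E, IsPath T x → IsPath T y → IsPath T z →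
      (∀ i, op (y i) (x i) = op (z i) (x i)) → y = z) :
    (∀ a, Function.Injective (op a)) ∧ ∀ b, Function.Injective fun a => op a b := by
  obtain ⟨p, hp, hper⟩ := exists_common_period T
  let R := {a : E // Walk T p a a}
  let opR : R → R → R := fun a b => ⟨op a.1 b.1, a.2.op hop b.2⟩
  have hlR : ∀ a b, ∃ c, opR a c = b := by
    intro a b
    obtain ⟨x, hx⟩ := a.2.exists_periodicPath hp
    obtain ⟨z, hz⟩ := b.2.exists_periodicPath hp
    obtain ⟨y, hy⟩ := PeriodicPath.exists_op_eq hop hl hp x z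
    exact ⟨⟨y.1 0, y.1, y.2.1, rfl, by simpa using y.2.2 0⟩,
      Subtype.ext (by simpa [opR, hx, hz] using hy 0)⟩
  have hrR : ∀ a b, ∃ c, opR c a = b := by
    intro a b
    obtain ⟨x, hx⟩ := a.2.exists_periodicPath hp
    obtain ⟨z, hz⟩ := b.2.exists_periodicPath hp
    obtain ⟨y, hy⟩ := PeriodicPath.exists_op_eq (op := fun a b => op b a)
      (fun h h' => hop h' h) hr hp x z
    exact ⟨⟨y.1 0, y.1, y.2.1, rfl, by simpa using y.2.2 0⟩,
      Subtype.ext (by simpa [opR, hx, hz] using hy 0)⟩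
  have hlR' : ∀ a, Function.Injective (opR a) := fun a =>
    Finite.injective_iff_surjective.2 (hlR a)
  have hrR' : ∀ b, Function.Injective fun a => opR a b := fun b =>
    Finite.injective_iff_surjective.2 (hrR b)
  have hsymm : ∀ a b : R, (∃ t, Walk T (p * t) a.1 b.1) → ∃ t, Walk T (p * t) b.1 a.1 := by
    intro a b hab
    refine symm_of_compatible (r := fun a b : R => ∃ t, Walk T (p * t) a.1 b.1) (op := opR)
      (fun a => ⟨1, by simpa using a.2⟩) ?_ ?_ hlR hrR' hab
    · rintro a b c ⟨t, h⟩ ⟨s, h'⟩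
      exact ⟨t + s, by rw [mul_add]; exact h.trans h'⟩
    · rintro a b c ⟨t, h⟩
      exact ⟨t, h.op hop (c.2.iterate t)⟩
  have hall : ∀ a, Walk T p a a := by
    intro a
    obtain ⟨x, hx, rfl⟩ := hE a
    have key : ∀ s t : ℕ, s < t → ∀ i : ℤ, x i = x (i + (p * (t - s) : ℕ)) → Walk T p (x i) (x i) := by
      intro s t hst i hi
      refine hper _ (p * (t - s)) (Nat.mul_pos hp (by omega)) ?_
      have := hx.walk i (p * (t - s))
      rwa [← hi] at this
    have pigeon : ∀ f : ℕ → E, ∃ s t, s < t ∧ f s = f t := by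
      intro f
      obtain ⟨s, t, hst, h⟩ := Finite.exists_ne_map_eq_of_infinite f
      rcases lt_or_gt_of_ne hst with h' | h'
      · exact ⟨s, t, h', h⟩
      · exact ⟨t, s, h', h.symm⟩
    -- A repetition among the times divisible by `p` gives a letter of `R` in the future of `x 0`,
    -- and likewise one in its past.
    obtain ⟨s, t, hst, h⟩ := pigeon fun k => x ((p * k : ℕ) : ℤ)
    have hb : Walk T p (x (p * s : ℕ)) (x (p * s : ℕ)) := by
      refine key s t hst _ (h.trans (congrArg x ?_))
      rw [Nat.mul_sub, Nat.cast_sub (Nat.mul_le_mul_left p hst.le)]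
      ring
    -- The shift to `k + 1` makes the walk from the past letter to `x 0` nontrivial, so the closed
    -- walk built at the end has positive length even if `s = 0`.
    obtain ⟨s', t', hst', h'⟩ := pigeon fun k => x (-((p * (k + 1) : ℕ) : ℤ))
    have ha : Walk T p (x (-((p * (t' + 1) : ℕ) : ℤ))) (x (-((p * (t' + 1) : ℕ) : ℤ))) := by
      refine key s' t' hst' _ (h'.symm.trans (congrArg x ?_))
      rw [Nat.mul_sub, Nat.cast_sub (Nat.mul_le_mul_left p hst'.le)]
      push_cast
      ring
    have w1 : Walk T (p * (t' + 1)) (x (-((p * (t' + 1) : ℕ) : ℤ))) (x 0) := by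
      have := hx.walk (-((p * (t' + 1) : ℕ) : ℤ)) (p * (t' + 1))
      rwa [neg_add_cancel] at this
    have w2 : Walk T (p * s) (x 0) (x (p * s : ℕ)) := by
      simpa using hx.walk 0 (p * s)
    obtain ⟨u, hu⟩ := hsymm ⟨_, ha⟩ ⟨_, hb⟩ ⟨t' + 1 + s, by rw [mul_add]; exact w1.trans w2⟩
    refine hper _ _ ?_ ((w2.trans hu).trans w1)
    have : 0 < p * (t' + 1) := by positivity
    omega
  refine ⟨fun a b c h => ?_, fun a b c h => ?_⟩
  · exact congrArg Subtype.val
      (hlR' ⟨a, hall a⟩ (a₁ := ⟨b, hall b⟩) (a₂ := ⟨c, hall c⟩) (Subtype.ext h))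
  · exact congrArg Subtype.val
      (hrR' ⟨a, hall a⟩ (a₁ := ⟨b, hall b⟩) (a₂ := ⟨c, hall c⟩) (Subtype.ext h))

end Walks


/-! ### Quasigroup graphs and their follower quotients -/

section Graph

variable {E : Type*}

/-- A quasigroup operation on the vertices of a directed graph without sources and sinks whose
edges are closed under the componentwise operation. -/
structure IsQuasigroupGraph (op : E → E → E) (T : E → E → Prop) : Prop where
  inj_left : ∀ a, Function.Injective (op a)
  inj_right : ∀ b, Function.Injective fun a => op a b
  compat : ∀ {a b c d}, T a b → T c d → T (op a c) (op b d)
  exists_succ : ∀ a, ∃ b, T a b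
  exists_pred : ∀ b, ∃ a, T a b

/-- Two vertices are equivalent if they have the same followers. -/
def followSetoid (T : E → E → Prop) : Setoid E where
  r a b := ∀ c, T a c ↔ T b c
  iseqv := ⟨fun _ _ => Iff.rfl, fun h c => (h c).symm, fun h h' c => (h c).trans (h' c)⟩

namespace IsQuasigroupGraph

variable {op : E → E → E} {T : E → E → Prop}

lemma flip (h : IsQuasigroupGraph op T) : IsQuasigroupGraph op (flip T) :=
  ⟨h.inj_left, h.inj_right, fun h1 h2 => h.compat h1 h2, h.exists_pred, h.exists_succ⟩

variable [Finite E]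

lemma exists_op_left (h : IsQuasigroupGraph op T) (a b : E) : ∃ c, op a c = b :=
  Finite.surjective_of_injective (h.inj_left a) b

lemma exists_op_right (h : IsQuasigroupGraph op T) (a b : E) : ∃ c, op c a = b :=
  Finite.surjective_of_injective (h.inj_right a) b

lemma ncard_follow (h : IsQuasigroupGraph op T) (a b : E) :
    {c | T a c}.ncard ≤ {c | T b c}.ncard := by
  obtain ⟨d, rfl⟩ := h.exists_op_left a b
  obtain ⟨e, he⟩ := h.exists_succ d
  exact Set.ncard_le_ncard_of_injOn (fun x => op x e) (fun x hx => h.compat hx he)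
    (h.inj_right e).injOn

/-- Right translation by `c` maps the followers of `b` injectively into those of `op b a`. All
follower sets have the same size, so it is onto. -/
lemma exists_follow_left (h : IsQuasigroupGraph op T) {a b c x : E} (hc : T a c)
    (hx : T (op b a) x) : ∃ d, T b d ∧ op d c = x := by
  have hsub : (fun d => op d c) '' {d | T b d} ⊆ {x | T (op b a) x} := by
    rintro _ ⟨d, hd, rfl⟩
    exact h.compat hd hc
  have := Set.eq_of_subset_of_ncard_le hsub (by
    rw [Set.ncard_image_of_injective _ (h.inj_right c)]
    exact h.ncard_follow _ _)
  have hx' : x ∈ {x | T (op b a) x} := hx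
  rwa [← this] at hx'

lemma exists_follow_right (h : IsQuasigroupGraph op T) {a b c x : E} (hc : T a c)
    (hx : T (op a b) x) : ∃ d, T b d ∧ op c d = x :=
  exists_follow_left (op := fun a b => op b a) ⟨h.inj_right, h.inj_left,
    fun h1 h2 => h.compat h2 h1, h.exists_succ, h.exists_pred⟩ hc hx

/-- The follower sets of two vertices are equal or disjoint. -/
lemma followSetoid_of_common (h : IsQuasigroupGraph op T) {a b c : E} (ha : T a c) (hb : T b c) :
    followSetoid T a b := by
  -- Write `op e x`, a follower of `op a a`, as `op d c`. Since `c` also follows `b`, this element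
  -- follows `op a b`; dividing by `e` on the left recovers `x` as a follower of `b`.
  have key : ∀ {a b}, T a c → T b c → ∀ x, T a x → T b x := by
    intro a b ha hb x hx
    obtain ⟨e, he⟩ := h.exists_succ a
    obtain ⟨d, hd, hdc⟩ := h.exists_follow_left ha (h.compat he hx)
    have h1 : T (op a b) (op e x) := hdc ▸ h.compat hd hb
    obtain ⟨y, hy, hyx⟩ := h.exists_follow_right he h1
    rwa [← h.inj_left e hyx]
  exact fun x => ⟨key ha hb x, key hb ha x⟩

lemma followSetoid_op (h : IsQuasigroupGraph op T) {a a' b b' : E} (ha : followSetoid T a a')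
    (hb : followSetoid T b b') : followSetoid T (op a b) (op a' b') := by
  obtain ⟨c, hc⟩ := h.exists_succ a
  obtain ⟨d, hd⟩ := h.exists_succ b
  exact h.followSetoid_of_common (h.compat hc hd) (h.compat ((ha c).1 hc) ((hb d).1 hd))

/-- The operation induced on the classes of vertices with the same followers. -/
def quotOp (h : IsQuasigroupGraph op T) (q r : Quotient (followSetoid T)) :
    Quotient (followSetoid T) :=
  Quotient.map₂ op (fun _ _ ha _ _ hb => h.followSetoid_op ha hb) q r

/-- The edges between classes of vertices with the same followers. -/
def quotRel (T : E → E → Prop) (q r : Quotient (followSetoid T)) : Prop :=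
  ∃ a b, ⟦a⟧ = q ∧ ⟦b⟧ = r ∧ T a b

/-- Divisibility passes to quotients, and on a finite set it gives back cancellation. -/
lemma quotient (h : IsQuasigroupGraph op T) : IsQuasigroupGraph h.quotOp (quotRel T) where
  inj_left q := by
    refine Finite.injective_iff_surjective.2 ?_
    induction q using Quotient.inductionOn with
    | h a =>
    refine Quotient.ind fun b => ?_
    obtain ⟨c, rfl⟩ := h.exists_op_left a b
    exact ⟨⟦c⟧, rfl⟩
  inj_right q := by
    refine Finite.injective_iff_surjective.2 ?_
    induction q using Quotient.inductionOn with
    | h a =>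
    refine Quotient.ind fun b => ?_
    obtain ⟨c, rfl⟩ := h.exists_op_right a b
    exact ⟨⟦c⟧, rfl⟩
  compat := by
    rintro _ _ _ _ ⟨a, b, rfl, rfl, hab⟩ ⟨c, d, rfl, rfl, hcd⟩
    exact ⟨op a c, op b d, rfl, rfl, h.compat hab hcd⟩
  exists_succ := by
    refine Quotient.ind fun a => ?_
    obtain ⟨b, hb⟩ := h.exists_succ a
    exact ⟨⟦b⟧, a, b, rfl, rfl, hb⟩
  exists_pred := by
    refine Quotient.ind fun b => ?_
    obtain ⟨a, ha⟩ := h.exists_pred b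
    exact ⟨⟦a⟧, a, b, rfl, rfl, ha⟩

/-- The classes of a congruence of a finite quasigroup have the same size, so that a label
in `Fin d` can be chosen which enumerates each of them. -/
lemma exists_label (h : IsQuasigroupGraph op T) {s : Setoid E}
    (hs : ∀ {a a' b}, s a a' → s (op a b) (op a' b)) :
    ∃ (d : ℕ) (t : E → Fin d), (∀ a b, s a b → t a = t b → a = b) ∧
      ∀ a i, ∃ b, s a b ∧ t b = i := by
  rcases isEmpty_or_nonempty E with hE | ⟨⟨e⟩⟩
  · exact ⟨0, hE.elim, fun a => hE.elim a, fun a => hE.elim a⟩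
  -- Right translation by `d` embeds the class of `a` into that of `op a d`, and every element has
  -- the latter form.
  have le : ∀ a b, Nat.card {c // s a c} ≤ Nat.card {c // s b c} := by
    intro a b
    obtain ⟨d, rfl⟩ := h.exists_op_left a b
    exact Nat.card_le_card_of_injective
      (fun c : {c // s a c} => (⟨op c.1 d, hs c.2⟩ : {c // s (op a d) c}))
      fun c c' hc => Subtype.ext (h.inj_right d (congrArg Subtype.val hc))
  have eqv : ∀ q : Quotient s, Nonempty ({c // ⟦c⟧ = q} ≃ Fin (Nat.card {c // s e c})) := by
    refine Quotient.ind fun a => ?_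
    have e1 : {c // (⟦c⟧ : Quotient s) = ⟦a⟧} ≃ {c // s a c} :=
      Equiv.subtypeEquivRight fun c => Quotient.eq.trans ⟨s.symm, s.symm⟩
    exact ⟨e1.trans (Finite.equivFinOfCardEq (le_antisymm (le a e) (le e a)))⟩
  refine ⟨_, fun a => (eqv ⟦a⟧).some ⟨a, rfl⟩, fun a b hab ht => ?_, fun a i => ?_⟩
  · have key : ∀ (q r : Quotient s) (hq : ⟦a⟧ = q) (hr : ⟦b⟧ = r), q = r →
        (eqv q).some ⟨a, hq⟩ = (eqv r).some ⟨b, hr⟩ → a = b := by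
      rintro q r hq hr rfl H
      exact congrArg Subtype.val ((eqv q).some.injective H)
    exact key _ _ rfl rfl (Quotient.sound hab) ht
  · have hb := ((eqv ⟦a⟧).some.symm i).2
    refine ⟨((eqv ⟦a⟧).some.symm i).1, s.symm (Quotient.exact hb), ?_⟩
    have key : ∀ (q : Quotient s) (hq : ⟦((eqv ⟦a⟧).some.symm i).1⟧ = q), q = ⟦a⟧ →
        (eqv q).some ⟨((eqv ⟦a⟧).some.symm i).1, hq⟩ = i := by
      rintro q hq rfl
      exact (eqv _).some.apply_symm_apply i
    exact key _ rfl hb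

end IsQuasigroupGraph

end Graph

/-! ### Coding paths by a permutation and free labels -/

/-- A labelling of the vertices of the graph `T` by `Fin m × Fin n` which codes the path space of
`T` as the product of the orbits of a permutation `τ` of `Fin m` with the full `n`-shift. -/
structure PathCode {E : Type*} (op : E → E → E) (T : E → E → Prop) (m n : ℕ) where
  g : E → Fin m
  h : E → Fin n
  τ : Fin m → Fin m
  opF : Fin m → Fin m → Fin m
  K : ℕ
  g_surjective : Function.Surjective g
  τ_injective : Function.Injective τ
  g_op : ∀ a b, g (op a b) = opF (g a) (g b)
  g_succ : ∀ {a b}, T a b → g b = τ (g a)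
  eq_of_window : ∀ {x y : ℤ → E}, IsPath T x → IsPath T y → ∀ j,
    (∀ i ≤ K, g (x (j - i)) = g (y (j - i)) ∧ h (x (j - i)) = h (y (j - i))) → x j = y j
  exists_path : ∀ (φ : ℤ → Fin m) (c : ℤ → Fin n), (∀ i, φ (i + 1) = τ (φ i)) →
    ∃ x, IsPath T x ∧ ∀ i, g (x i) = φ i ∧ h (x i) = c i

namespace IsQuasigroupGraph

/-- Vertices with a common follower coincide, so predecessors are unique, and taking the predecessor
is a permutation. A path is an orbit of its inverse: no free label (`n = 1`) and no memory (`K = 0`)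
are needed. -/
lemma exists_pathCode_of_injective {E : Type*} [Finite E] {op : E → E → E} {T : E → E → Prop}
    (h : IsQuasigroupGraph op T) (hT : ∀ {a b}, followSetoid T a b → a = b) :
    ∃ m n, Nonempty (PathCode op T m n) := by
  choose pre hpre using h.exists_pred
  have hpre' : ∀ {a b}, T a b → a = pre b := fun hab => hT (h.followSetoid_of_common hab (hpre _))
  have hbij : Function.Bijective pre := Function.Surjective.bijective_of_finite fun a => by
    obtain ⟨b, hb⟩ := h.exists_succ a
    exact ⟨b, (hpre' hb).symm⟩
  let σ := Equiv.ofBijective pre hbij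
  let e := Finite.equivFin E
  refine ⟨_, 1, ⟨⟨e, fun _ => 0, fun i => e (σ.symm (e.symm i)),
    fun i j => e (op (e.symm i) (e.symm j)), 0, e.surjective,
    e.injective.comp (σ.symm.injective.comp e.symm.injective), by simp, ?_, ?_, ?_⟩⟩⟩
  · intro a b hab
    simp [σ, hpre' hab]
  · intro x y _ _ j H
    simpa using H 0 le_rfl
  · intro φ c hφ
    refine ⟨fun i => e.symm (φ i), fun i => ?_, fun i => ⟨by simp, Subsingleton.elim _ _⟩⟩
    have := hpre (e.symm (φ (i + 1)))
    rw [hφ] at this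
    beta_reduce
    rw [hφ]
    have h2 : pre (e.symm (e (σ.symm (e.symm (φ i))))) = e.symm (φ i) := by
      rw [Equiv.symm_apply_apply]
      exact σ.apply_symm_apply _
    rwa [h2] at this

/-- A code of the graph of the classes of vertices with the same followers lifts to a code of the
graph itself. -/
lemma exists_pathCode_of_quotient {E : Type*} [Finite E] {op : E → E → E} {T : E → E → Prop}
    (h : IsQuasigroupGraph op T) {m n : ℕ} (C : PathCode h.quotOp (quotRel T) m n) :
    ∃ m n, Nonempty (PathCode op T m n) := by
  -- The label `t` need only separate vertices having both the same followers and the same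
  -- predecessors: the quotient path supplies the rest.
  obtain ⟨d, t, ht, ht'⟩ := h.exists_label (s := followSetoid T ⊓ followSetoid (_root_.flip T))
    (fun {a a' b} hs => ⟨h.followSetoid_op hs.1 (Setoid.refl' _ _),
      h.flip.followSetoid_op hs.2 (Setoid.refl' _ _)⟩)
  have hpath : ∀ {x : ℤ → E}, IsPath T x →
      IsPath (quotRel T) fun i => (⟦x i⟧ : Quotient (followSetoid T)) :=
    fun hx i => ⟨_, _, rfl, rfl, hx i⟩
  refine ⟨m, n * d, ⟨⟨fun a => C.g ⟦a⟧, fun a => finProdFinEquiv (C.h ⟦a⟧, t a), C.τ, C.opF,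
    C.K + 1, C.g_surjective.comp Quotient.mk_surjective, C.τ_injective,
    fun a b => C.g_op ⟦a⟧ ⟦b⟧, fun hab => C.g_succ ⟨_, _, rfl, rfl, hab⟩, ?_, ?_⟩⟩⟩
  · intro x y hx hy j H
    simp only [EmbeddingLike.apply_eq_iff_eq, Prod.mk.injEq] at H
    have h1 : (⟦x j⟧ : Quotient (followSetoid T)) = ⟦y j⟧ :=
      C.eq_of_window (hpath hx) (hpath hy) j fun i hi =>
        ⟨(H i (by omega)).1, (H i (by omega)).2.1⟩
    have h2 : (⟦x (j - 1)⟧ : Quotient (followSetoid T)) = ⟦y (j - 1)⟧ :=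
      C.eq_of_window (hpath hx) (hpath hy) (j - 1) fun i hi => by
        have := H (i + 1) (by omega)
        rw [show j - ((i + 1 : ℕ) : ℤ) = j - 1 - i by push_cast; ring] at this
        exact ⟨this.1, this.2.1⟩
    have hx1 := hx (j - 1)
    have hy1 := hy (j - 1)
    rw [sub_add_cancel] at hx1 hy1
    -- Equal classes at time `j - 1` make `y (j - 1)` a common predecessor of `x j` and `y j`. This
    -- is where the extra unit of memory is spent.
    have hx2 : T (y (j - 1)) (x j) := (Quotient.exact h2 _).1 hx1
    refine ht _ _ ⟨Quotient.exact h1, h.flip.followSetoid_of_common hx2 hy1⟩ ?_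
    simpa using (H 0 (by omega)).2.2
  · intro φ c hφ
    obtain ⟨y, hy, hyc⟩ := C.exists_path φ (fun i => (finProdFinEquiv.symm (c i)).1) hφ
    have hlift : ∀ i, ∃ b, ⟦b⟧ = y i ∧ t b = (finProdFinEquiv.symm (c i)).2 ∧
        ∀ a, ⟦a⟧ = y (i - 1) → T a b := by
      intro i
      have := hy (i - 1)
      rw [sub_add_cancel] at this
      obtain ⟨a, b, ha, hb, hab⟩ := this
      obtain ⟨b', hbb, hb'⟩ := ht' b (finProdFinEquiv.symm (c i)).2
      -- Relabelling `b` as `b'` keeps its predecessors, and these include the whole class at time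
      -- `i - 1`. The choices at different times are therefore independent.
      refine ⟨b', by rw [← hb]; exact Quotient.sound (Setoid.symm' _ hbb.1), hb', fun a' ha' => ?_⟩
      have h1 : followSetoid T a' a := Quotient.exact (ha'.trans ha.symm)
      exact (h1 b').2 ((hbb.2 a).1 hab)
    choose x hx1 hx2 hx3 using hlift
    refine ⟨x, fun i => hx3 (i + 1) (x i) (by rw [hx1, add_sub_cancel_right]), fun i => ?_⟩
    simp only [hx1, hx2]
    refine ⟨(hyc i).1, ?_⟩
    rw [(hyc i).2]
    exact finProdFinEquiv.apply_symm_apply (c i)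

/-- Induction on the number of vertices: unless distinct vertices always have distinct follower
sets, the quotient is strictly smaller. -/
theorem exists_pathCode {E : Type u} [Finite E] {op : E → E → E} {T : E → E → Prop}
    (h : IsQuasigroupGraph op T) : ∃ m n, Nonempty (PathCode op T m n) := by
  induction hN : Nat.card E using Nat.strong_induction_on generalizing E with
  | _ N ih =>
  by_cases hT : ∀ {a b}, followSetoid T a b → a = b
  · exact h.exists_pathCode_of_injective hT
  · push Not at hT
    obtain ⟨a, b, hab, hne⟩ := hT
    have hlt : Nat.card (Quotient (followSetoid T)) < N := by
      subst hN
      have := Fintype.ofFinite E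
      classical
      have := Fintype.ofFinite (Quotient (followSetoid T))
      rw [Nat.card_eq_fintype_card, Nat.card_eq_fintype_card]
      exact Fintype.card_lt_of_surjective_not_injective _ Quotient.mk_surjective
        fun hinj => hne (hinj (Quotient.sound hab))
    obtain ⟨m, n, ⟨C⟩⟩ := ih _ hlt h.quotient rfl
    exact h.exists_pathCode_of_quotient C

end IsQuasigroupGraph


/-! ### Dense orbits and a universal sequence -/

section Shift

variable {A : Type*}

lemma ShiftSpace.iterate_shiftMap_apply [TopologicalSpace A] (Λ : ShiftSpace A) (k : ℕ) (x : Λ.Pt)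
    (i : ℤ) : (Λ.shiftMap^[k] x).1 i = x.1 (i + k) := by
  induction k generalizing x with
  | zero => simp
  | succ k ih =>
    rw [Function.iterate_succ_apply, ih]
    show x.1 (i + k + 1) = _
    rw [Nat.cast_succ, add_assoc]

open Filter Topology in
lemma ShiftSpace.dense_range_iterate [TopologicalSpace A] {Λ : ShiftSpace A} {x : Λ.Pt}
    (H : ∀ (y : Λ.Pt) (N : ℕ), ∃ k : ℕ, ∀ i : ℤ, |i| ≤ N → x.1 (i + k) = y.1 i) :
    Dense (Set.range fun n : ℕ => Λ.shiftMap^[n] x) := by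
  intro y
  choose k hk using H y
  refine mem_closure_of_tendsto (f := fun N => Λ.shiftMap^[k N] x) (b := atTop) ?_
    (Eventually.of_forall fun N => ⟨k N, rfl⟩)
  rw [tendsto_subtype_rng, tendsto_pi_nhds]
  intro i
  refine tendsto_const_nhds.congr' ?_
  filter_upwards [eventually_ge_atTop i.natAbs] with N hN
  rw [Λ.iterate_shiftMap_apply]
  exact (hk N i (by rw [Int.abs_eq_natAbs]; exact_mod_cast hN)).symm

lemma ShiftSpace.exists_iterate_eq [TopologicalSpace A] [DiscreteTopology A] {Λ : ShiftSpace A}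
    {x : Λ.Pt} (H : Dense (Set.range fun n : ℕ => Λ.shiftMap^[n] x)) (y : Λ.Pt) :
    ∃ k : ℕ, x.1 k = y.1 0 := by
  have hc : Continuous fun z : Λ.Pt => z.1 0 := (continuous_apply 0).comp continuous_subtype_val
  obtain ⟨_, ⟨k, rfl⟩, hz⟩ := H.exists_mem_open ((isOpen_discrete {y.1 0}).preimage hc) ⟨y, rfl⟩
  refine ⟨k, ?_⟩
  have : (Λ.shiftMap^[k] x).1 0 = y.1 0 := hz
  rwa [Λ.iterate_shiftMap_apply, zero_add] at this

/-- Every window of every sequence occurs in the positive half of a suitable sequence. -/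
lemma exists_universal_sequence [Finite A] [Nonempty A] :
    ∃ c : ℤ → A, ∀ (w : ℤ → A) (N : ℕ), ∃ k : ℕ, ∀ i : ℤ, |i| ≤ N → c (i + k) = w i := by
  let : TopologicalSpace A := ⊥
  have : DiscreteTopology A := ⟨rfl⟩
  obtain ⟨u, hu⟩ := TopologicalSpace.exists_dense_seq (ℤ → A)
  -- With `k = Nat.pair e N`, the positions from `2 ^ (k + 1)` up to `2 ^ (k + 2)` carry a copy of
  -- `u e` centred at `3 * 2 ^ k`. The radius `2 ^ k` exceeds `N`, which is why `N` is encoded in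
  -- `k`.
  refine ⟨fun j => u (Nat.unpair (Nat.log 2 j.toNat - 1)).1
    (j - 3 * 2 ^ (Nat.log 2 j.toNat - 1)), fun w N => ?_⟩
  have hopen : IsOpen ((Set.Icc (-N : ℤ) N).pi fun i => {w i}) :=
    isOpen_set_pi (Set.finite_Icc _ _) fun i _ => isOpen_discrete _
  obtain ⟨e, hz⟩ := hu.exists_mem_open hopen ⟨w, fun i _ => rfl⟩
  have hN : N < 2 ^ Nat.pair e N := (Nat.right_le_pair e N).trans_lt Nat.lt_two_pow_self
  refine ⟨3 * 2 ^ Nat.pair e N, fun i hi => ?_⟩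
  have hi' := abs_le.1 hi
  have hlog : Nat.log 2 (i + ((3 * 2 ^ Nat.pair e N : ℕ) : ℤ)).toNat = Nat.pair e N + 1 := by
    refine Nat.log_eq_of_pow_le_of_lt_pow ?_ ?_ <;> · simp only [pow_succ]; omega
  simp only [hlog, Nat.add_sub_cancel, Nat.unpair_pair]
  have h3 : i + ((3 * 2 ^ Nat.pair e N : ℕ) : ℤ) - 3 * 2 ^ Nat.pair e N = i := by
    push_cast
    ring
  rw [h3]
  exact hz i hi'

end Shift

/-! ### Entropy bounds -/

section Entropy

variable {A : Type*} [UniformSpace A]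

open Uniformity Dynamics

/-- Separated sets have at most as many elements as the space, and a constant bound has zero
exponential growth. -/
lemma ShiftSpace.entropy_eq_zero_of_finite (Λ : ShiftSpace A) [Finite Λ.Pt] [Nonempty Λ.Pt] :
    Λ.entropy = 0 := by
  refine le_antisymm ?_ (coverEntropy_nonneg _ Set.univ_nonempty)
  rw [ShiftSpace.entropy, coverEntropy_eq_iSup_netEntropyEntourage]
  refine iSup₂_le fun U _ => ?_
  have := Fintype.ofFinite Λ.Pt
  have hcard : (Fintype.card Λ.Pt : ENNReal) ≠ 0 := by
    exact_mod_cast Fintype.card_ne_zero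
  rw [← ExpGrowth.expGrowthSup_const hcard (ENNReal.natCast_ne_top _)]
  refine ExpGrowth.expGrowthSup_monotone fun n => ?_
  have : netMaxcard Λ.shiftMap Set.univ U n ≤ (Fintype.card Λ.Pt : ℕ∞) :=
    iSup₂_le fun s _ => by exact_mod_cast s.card_le_univ
  exact (ENat.toENNReal_mono this).trans_eq (by simp only [ENat.toENNReal_coe])

/-- Points realizing the `n ^ N` label words of length `N` are separated at the scale "same letter
at `0`", so the entropy is at least `log n`. -/
lemma ShiftSpace.entropy_pos_of_label [DiscreteUniformity A] (Λ : ShiftSpace A) {n : ℕ} (hn : 1 < n)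
    (f : A → Fin n) (hf : ∀ c : ℤ → Fin n, ∃ x : Λ.Pt, ∀ i, f (x.1 i) = c i) :
    0 < Λ.entropy := by
  classical
  have hU : {p : Λ.Pt × Λ.Pt | p.1.1 0 = p.2.1 0} ∈ 𝓤 Λ.Pt := by
    have huc : UniformContinuous fun x : Λ.Pt => x.1 0 :=
      (Pi.uniformContinuous_proj _ 0).comp uniformContinuous_subtype_val
    exact huc (DiscreteUniformity.relId_mem_uniformity A)
  refine lt_of_lt_of_le ?_ (netEntropyEntourage_le_coverEntropy _ _ hU)
  have hlog : 0 < ENNReal.log (n : ENNReal) := by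
    rw [← ENNReal.log_one, ENNReal.log_lt_log_iff]
    exact_mod_cast hn
  refine hlog.trans_le ?_
  rw [← ExpGrowth.expGrowthSup_pow]
  refine ExpGrowth.expGrowthSup_monotone fun N => ?_
  have hpt : ∀ w : Fin N → Fin n, ∃ x : Λ.Pt, ∀ i : Fin N, f (x.1 ((i : ℕ) : ℤ)) = w i := by
    intro w
    obtain ⟨x, hx⟩ := hf fun i => if h : i.toNat < N then w ⟨i.toNat, h⟩ else ⟨0, by omega⟩
    exact ⟨x, fun i => by simp [hx]⟩
  choose x hx using hpt
  have hinj : Function.Injective x := fun w w' h => funext fun i => by rw [← hx w, ← hx w', h]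
  have hnet : IsDynNetIn Λ.shiftMap Set.univ {p : Λ.Pt × Λ.Pt | p.1.1 0 = p.2.1 0} N
      (Finset.univ.image x : Finset Λ.Pt) := by
    refine ⟨Set.subset_univ _, fun y hy z hz hyz => Set.disjoint_left.2 fun v hv hv' => hyz ?_⟩
    simp only [Finset.coe_image, Finset.coe_univ, Set.image_univ, Set.mem_range] at hy hz
    obtain ⟨w, rfl⟩ := hy
    obtain ⟨w', rfl⟩ := hz
    refine congrArg x (funext fun i => ?_)
    have h1 := mem_ball_dynEntourage.1 hv i i.2
    have h2 := mem_ball_dynEntourage.1 hv' i i.2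
    simp only [UniformSpace.ball, Set.mem_preimage, Set.mem_ofPred_eq,
      Λ.iterate_shiftMap_apply, zero_add] at h1 h2
    rw [← hx w, ← hx w', h1, h2]
  have := ENat.toENNReal_mono hnet.card_le_netMaxcard
  rw [Finset.card_image_of_injective _ hinj] at this
  simpa using this

end Entropy


/-! ### From the Markov shift to a quasigroup graph -/

section MarkovShift

variable {A : Type u} [TopologicalSpace A] [DiscreteTopology A] {M : Matrix A A ℕ}

/-- The letters which occur in the points of a Markov shift. -/
abbrev Letter (M : Matrix A A ℕ) : Type u := {a : A // ∃ x : (markovShift M).Pt, x.1 0 = a}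

/-- The allowed transitions between the letters of a Markov shift. -/
def Letter.Rel (a b : Letter M) : Prop := M a.1 b.1 = 1

/-- The path of letters of a point of a Markov shift. -/
def toPath (x : (markovShift M).Pt) (i : ℤ) : Letter M :=
  ⟨x.1 i, ⟨fun j => x.1 (j + i), fun j => by
    have := x.2 (j + i)
    rwa [add_right_comm] at this⟩, by simp⟩

lemma isPath_toPath (x : (markovShift M).Pt) : IsPath Letter.Rel (toPath x) := fun i => x.2 i

/-- The point of a Markov shift which is given by a path of letters. -/
def ofPath (x : ℤ → Letter M) (hx : IsPath Letter.Rel x) : (markovShift M).Pt :=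
  ⟨fun i => (x i).1, hx⟩

lemma toPath_ofPath (x : ℤ → Letter M) (hx : IsPath Letter.Rel x) : toPath (ofPath x hx) = x := rfl

lemma toPath_injective : Function.Injective (toPath (M := M)) := fun _ _ h =>
  Subtype.ext (funext fun i => congrArg Subtype.val (congrFun h i))

lemma Letter.exists_path (a : Letter M) : ∃ x, IsPath Letter.Rel x ∧ x 0 = a := by
  obtain ⟨a, x, rfl⟩ := a
  exact ⟨toPath x, isPath_toPath x, rfl⟩

/-- A `1`-block quasigroup operation on a Markov shift is induced by a quasigroup operation on its
letters. -/
lemma exists_isQuasigroupGraph [Finite A]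
    {op : (markovShift M).Pt → (markovShift M).Pt → (markovShift M).Pt}
    (hq : IsQuasigroup op) (hop : IsOneBlockOp op) :
    ∃ opL : Letter M → Letter M → Letter M, IsQuasigroupGraph opL Letter.Rel ∧
      ∀ x y i, toPath (op x y) i = opL (toPath x i) (toPath y i) := by
  obtain ⟨ρ, hρ⟩ := hop
  have hr : ∀ x y i, (op x y).1 i = ρ (fun _ => x.1 i) (fun _ => y.1 i) := by
    intro x y i
    rw [hρ]
    congr 1 <;> · funext k; simp [window]
  let opL : Letter M → Letter M → Letter M := fun a b => ⟨ρ (fun _ => a.1) (fun _ => b.1), by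
    obtain ⟨a, x, rfl⟩ := a
    obtain ⟨b, y, rfl⟩ := b
    exact ⟨op x y, hr x y 0⟩⟩
  have hL : ∀ x y i, toPath (op x y) i = opL (toPath x i) (toPath y i) :=
    fun x y i => Subtype.ext (hr x y i)
  have hcompat : ∀ {a b c d : Letter M}, a.Rel b → c.Rel d → (opL a c).Rel (opL b d) := by
    -- An allowed edge occurs in a point: the past of a path through `a` is glued to the future of a
    -- path through `b`.
    have key : ∀ {a b : Letter M}, a.Rel b → ∃ x, toPath x 0 = a ∧ toPath x 1 = b := by
      intro a b hab
      obtain ⟨x, hx, hx0⟩ := a.exists_path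
      obtain ⟨y, hy, hy0⟩ := b.exists_path
      have h := hx.glue (hy.shift_add (-1)) (k := 0) (by simpa [hx0, hy0] using hab)
      exact ⟨ofPath _ h, by rw [toPath_ofPath]; simp [hx0], by rw [toPath_ofPath]; simp [hy0]⟩
    intro a b c d hab hcd
    obtain ⟨x, rfl, rfl⟩ := key hab
    obtain ⟨y, rfl, rfl⟩ := key hcd
    rw [← hL, ← hL]
    exact isPath_toPath _ 0
  have hinj := injective_of_path_cancel Letter.exists_path hcompat
    (fun x y z hx hy hz h => by
      have h1 : op (ofPath x hx) (ofPath y hy) = op (ofPath x hx) (ofPath z hz) :=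
        toPath_injective (funext fun i => by rw [hL, hL]; exact h i)
      exact congrArg toPath ((hq.1 _ _ _).1 h1))
    (fun x y z hx hy hz h => by
      have h1 : op (ofPath y hy) (ofPath x hx) = op (ofPath z hz) (ofPath x hx) :=
        toPath_injective (funext fun i => by rw [hL, hL]; exact h i)
      exact congrArg toPath ((hq.2 _ _ _).1 h1))
  refine ⟨opL, ⟨hinj.1, hinj.2, hcompat, fun a => ?_, fun b => ?_⟩, hL⟩
  · obtain ⟨x, hx, rfl⟩ := a.exists_path
    exact ⟨_, hx 0⟩
  · obtain ⟨x, hx, rfl⟩ := b.exists_path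
    exact ⟨x (-1), hx (-1)⟩

end MarkovShift

/-! ### The finite factor -/

/-- The finite shift space of the orbits of a permutation of the alphabet. -/
def orbitShift {m : ℕ} (τ : Fin m → Fin m) : ShiftSpace (Fin m) where
  carrier := {φ | ∀ i : ℤ, φ (i + 1) = τ (φ i)}
  isClosed := by
    rw [Set.ofPred_forall]
    refine isClosed_iInter fun i => isClosed_eq (by fun_prop) ?_
    exact continuous_of_discreteTopology.comp (continuous_apply i)
  shift_mem_iff x := by
    constructor
    · intro h i
      have := h (i - 1)
      simpa [shift] using this
    · intro h i
      exact h (i + 1)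

/-- The map `τ` determines the future from one coordinate, and its injectivity determines the past.
-/
lemma orbitShift_ext {m : ℕ} {τ : Fin m → Fin m} (hτ : Function.Injective τ) {φ ψ : ℤ → Fin m}
    (hφ : φ ∈ (orbitShift τ).carrier) (hψ : ψ ∈ (orbitShift τ).carrier) {j : ℤ} (h : φ j = ψ j) :
    φ = ψ := by
  funext i
  induction i using Int.inductionOn' (b := j) with
  | zero => exact h
  | succ k _ ih => rw [hφ, hψ, ih]
  | pred k _ ih =>
    apply hτ
    rw [← hφ, ← hψ, sub_add_cancel, ih]

lemma finite_orbitShift {m : ℕ} {τ : Fin m → Fin m} (hτ : Function.Injective τ) :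
    (orbitShift τ).carrier.Finite :=
  Set.Finite.of_injOn (f := fun φ => φ 0) (t := Set.univ) (fun _ _ => Set.mem_univ _)
    (fun _ hφ _ hψ h => orbitShift_ext hτ hφ hψ h) Set.finite_univ

/-! ### The conjugacy, its inverse, and irreducibility -/

section Conjugacy

variable {A : Type u} [TopologicalSpace A] [DiscreteTopology A] {M : Matrix A A ℕ}
  {opL : Letter M → Letter M → Letter M} {m n : ℕ}

/-- The map of the path space of a graph which is defined by a code of the graph. -/
def PathCode.map (C : PathCode opL Letter.Rel m n) (x : (markovShift M).Pt) :
    ((orbitShift C.τ).prod (fullShift n)).Pt :=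
  ⟨fun i => (C.g (toPath x i), C.h (toPath x i)), fun i => C.g_succ (isPath_toPath x i),
    Set.mem_univ _⟩

lemma PathCode.map_bijective (C : PathCode opL Letter.Rel m n) : Function.Bijective C.map := by
  constructor
  · intro x y h
    refine toPath_injective (funext fun j => C.eq_of_window (isPath_toPath x) (isPath_toPath y) j
      fun i _ => ?_)
    exact Prod.ext_iff.1 (congrFun (congrArg Subtype.val h) (j - i))
  · intro z
    obtain ⟨x, hx, h⟩ := C.exists_path (fun i => (z.1 i).1) (fun i => (z.1 i).2) z.2.1
    exact ⟨ofPath x hx, Subtype.ext (funext fun i => Prod.ext (h i).1 (h i).2)⟩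

lemma PathCode.map_continuous (C : PathCode opL Letter.Rel m n) : Continuous C.map := by
  refine Continuous.subtype_mk (continuous_pi fun i => ?_) _
  have h1 : Continuous fun x : (markovShift M).Pt => toPath x i :=
    Continuous.subtype_mk ((continuous_apply i).comp continuous_subtype_val) _
  exact (continuous_of_discreteTopology (f := fun a => (C.g a, C.h a))).comp h1

/-- The conjugacy which is defined by a code of the graph of a Markov shift. -/
noncomputable def PathCode.homeomorph [Finite A] (C : PathCode opL Letter.Rel m n) :
    (markovShift M).Pt ≃ₜ ((orbitShift C.τ).prod (fullShift n)).Pt :=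
  haveI : CompactSpace (markovShift M).Pt :=
    isCompact_iff_compactSpace.1 (markovShift M).isClosed.isCompact
  Continuous.homeoOfEquivCompactToT2 (f := Equiv.ofBijective C.map C.map_bijective)
    C.map_continuous


/-- Allowing different times `i` and `j` makes the decoding rule independent of the position;
shifting `x` by `i - j` reduces to a single time. -/
lemma PathCode.eq_of_window_eq (C : PathCode opL Letter.Rel m n) {x y : (markovShift M).Pt}
    {i j : ℤ} (h : window C.K 0 (C.map x).1 i = window C.K 0 (C.map y).1 j) : x.1 i = y.1 j := by
  have key := C.eq_of_window ((isPath_toPath x).shift_add (i - j)) (isPath_toPath y) j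
    fun k hk => by
      have := congrFun h ⟨C.K - k, by omega⟩
      simp only [window, Nat.cast_sub hk] at this
      rw [show i - (C.K : ℤ) + (C.K - k) = j - k + (i - j) by ring,
        show j - (C.K : ℤ) + (C.K - k) = j - k by ring] at this
      exact Prod.ext_iff.1 this
  rw [add_sub_cancel] at key
  exact congrArg Subtype.val key

/-- The inverse of the conjugacy has memory `K` and anticipation `0`. -/
lemma PathCode.exists_symm_rule [Finite A] [Nonempty A] (C : PathCode opL Letter.Rel m n) :
    ∃ D : (Fin (C.K + 0 + 1) → Fin m × Fin n) → A, ∀ z j,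
      (C.homeomorph.symm z).1 j = D (window C.K 0 z.1 j) := by
  let f : (markovShift M).Pt × ℤ → Fin (C.K + 0 + 1) → Fin m × Fin n :=
    fun p => window C.K 0 (C.map p.1).1 p.2
  have hf : Function.FactorsThrough (fun p : (markovShift M).Pt × ℤ => p.1.1 p.2) f :=
    fun p q h => C.eq_of_window_eq h
  -- Words that do not occur as windows get an arbitrary letter.
  refine ⟨Function.extend f (fun p => p.1.1 p.2) fun _ => Classical.arbitrary A, fun z j => ?_⟩
  obtain ⟨x, rfl⟩ := C.homeomorph.surjective z
  rw [Homeomorph.symm_apply_apply]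
  exact (hf.extend_apply _ (x, j)).symm

lemma PathCode.isOneBlockCode [Finite A] (hne : (markovShift M).carrier.Nonempty)
    (C : PathCode opL Letter.Rel m n) : IsOneBlockCode C.homeomorph := by
  classical
  obtain ⟨x, hx⟩ := hne
  let a := toPath ⟨x, hx⟩ 0
  -- Symbols of `A` that occur in no point get the label of a fixed letter `a`.
  let f : A → Fin m × Fin n := fun b =>
    if h : ∃ x : (markovShift M).Pt, x.1 0 = b then (C.g ⟨b, h⟩, C.h ⟨b, h⟩) else (C.g a, C.h a)
  have hf : ∀ b : Letter M, f b.1 = (C.g b, C.h b) := fun b => dif_pos b.2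
  exact ⟨f, fun y j => (hf (toPath y j)).symm⟩

lemma fullShift_eq_singleton_iff {n : ℕ} : (∃ a : Fin n, (fullShift n).carrier = {fun _ => a}) ↔
    n = 1 := by
  constructor
  · rintro ⟨a, ha⟩
    have h : ∀ b : Fin n, b = a := fun b => by
      have : (fun _ => b) ∈ (fullShift n).carrier := Set.mem_univ _
      rw [ha] at this
      exact congrFun this 0
    have : Fintype.card (Fin n) = 1 := Fintype.card_eq_one_iff.2 ⟨a, h⟩
    simpa using this
  · rintro rfl
    exact ⟨0, Set.eq_singleton_iff_unique_mem.2
      ⟨Set.mem_univ _, fun _ _ => funext fun _ => Subsingleton.elim _ _⟩⟩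

lemma PathCode.orbitShift_eq_singleton_iff (C : PathCode opL Letter.Rel m n)
    (hne : (markovShift M).carrier.Nonempty) :
    (∃ e : ℤ → Fin m, (orbitShift C.τ).carrier = {e}) ↔ ∀ φ ψ : Fin m, φ = ψ := by
  constructor
  · rintro ⟨e, he⟩
    have h : ∀ φ, φ = e 0 := by
      intro φ
      obtain ⟨a, rfl⟩ := C.g_surjective φ
      obtain ⟨x, hx, rfl⟩ := a.exists_path
      have : (fun i => C.g (x i)) ∈ (orbitShift C.τ).carrier := fun i => C.g_succ (hx i)
      rw [he] at this
      exact congrFun this 0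
    exact fun φ ψ => (h φ).trans (h ψ).symm
  · intro h
    obtain ⟨x, hx⟩ := hne
    exact ⟨_, Set.eq_singleton_iff_unique_mem.2
      ⟨(C.map ⟨x, hx⟩).2.1, fun _ _ => funext fun _ => h _ _⟩⟩

lemma PathCode.irreducible_iff [Finite A] (C : PathCode opL Letter.Rel m n)
    (hne : (markovShift M).carrier.Nonempty) :
    (markovShift M).IsIrreducible ∧ (markovShift M).HasConstantSequence ↔
      ∀ φ ψ : Fin m, φ = ψ := by
  constructor
  · rintro ⟨⟨x, hx⟩, a, ha⟩
    let b := toPath ⟨_, ha⟩ 0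
    have hb : C.τ (C.g b) = C.g b := (C.g_succ (isPath_toPath ⟨_, ha⟩ 0)).symm
    have hmem : (fun i => C.g (toPath x i)) ∈ (orbitShift C.τ).carrier :=
      fun i => C.g_succ (isPath_toPath x i)
    have hmem' : (fun _ => C.g b) ∈ (orbitShift C.τ).carrier := fun _ => hb.symm
    have hhit : ∀ c : Letter M, ∃ k : ℕ, toPath x k = c := by
      rintro ⟨_, y, rfl⟩
      obtain ⟨k, hk⟩ := ShiftSpace.exists_iterate_eq hx y
      exact ⟨k, Subtype.ext hk⟩
    obtain ⟨k, hk⟩ := hhit b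
    -- The dense orbit visits the letter `b` of the constant sequence, so its `τ`-orbit meets a
    -- fixed point and is constant. Every letter lies on this orbit, hence every value of `g` is
    -- `C.g b`.
    have hconst := orbitShift_ext C.τ_injective hmem hmem' (j := k) (congrArg C.g hk)
    have hall : ∀ φ, φ = C.g b := by
      intro φ
      obtain ⟨c, rfl⟩ := C.g_surjective φ
      obtain ⟨l, rfl⟩ := hhit c
      exact congrFun hconst l
    exact fun φ ψ => (hall φ).trans (hall ψ).symm
  · intro H
    obtain ⟨x₀, hx₀⟩ := hne
    let p := (C.map ⟨x₀, hx₀⟩).1 0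
    have : Nonempty (Fin n) := ⟨p.2⟩
    constructor
    · obtain ⟨c, hc⟩ := exists_universal_sequence (A := Fin n)
      obtain ⟨x, hx, hxc⟩ := C.exists_path (fun _ => p.1) c fun _ => H _ _
      refine ⟨ofPath x hx, ShiftSpace.dense_range_iterate fun y N => ?_⟩
      -- Decoding the coordinates up to `N` in absolute value reads labels up to `C.K` further to
      -- the left.
      obtain ⟨k, hk⟩ := hc (fun i => C.h (toPath y i)) (N + C.K)
      refine ⟨k, fun i hi => ?_⟩
      refine C.eq_of_window_eq (funext fun l => Prod.ext (H _ _) ?_)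
      have hl := l.2
      have := hk (i - C.K + l) (by
        rw [abs_le] at hi ⊢
        push_cast
        omega)
      show C.h (x (i + k - C.K + l)) = _
      rw [(hxc _).2, show i + k - (C.K : ℤ) + l = i - C.K + l + k by ring, this]
      rfl
    · obtain ⟨x, hx, hxc⟩ := C.exists_path (fun _ => p.1) (fun _ => p.2) fun _ => H _ _
      -- All windows of the labels agree, so the decoded letters do.
      have hconst : ∀ i, (x i).1 = (x 0).1 := fun i =>
        C.eq_of_window_eq (x := ofPath x hx) (y := ofPath x hx) (funext fun l =>
          Prod.ext (H _ _) ((hxc _).2.trans (hxc _).2.symm))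
      refine ⟨(x 0).1, ?_⟩
      have := (ofPath x hx).2
      rwa [show (ofPath x hx).1 = fun _ => (x 0).1 from funext hconst] at this

end Conjugacy

/-! ### Entropy of the Markov shift -/

section Uniform

variable {A : Type u} [UniformSpace A] [DiscreteUniformity A] {M : Matrix A A ℕ}
  {opL : Letter M → Letter M → Letter M} {m n : ℕ}

lemma PathCode.entropy_eq_zero_iff (C : PathCode opL Letter.Rel m n)
    (hne : (markovShift M).carrier.Nonempty) : (markovShift M).entropy = 0 ↔ n = 1 := by
  classical
  have hne' : Nonempty (markovShift M).Pt := hne.to_subtype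
  obtain ⟨x₀⟩ := id hne'
  have hn : 0 < n := Fin.pos ((C.map x₀).1 0).2
  constructor
  · intro h0
    by_contra hn1
    let f : A → Fin n := fun a => if h : ∃ x : (markovShift M).Pt, x.1 0 = a then C.h ⟨a, h⟩ else
      ⟨0, hn⟩
    have hf : ∀ a : Letter M, f a.1 = C.h a := fun a => dif_pos a.2
    refine (ShiftSpace.entropy_pos_of_label (markovShift M) (by omega) f fun c => ?_).ne' h0
    obtain ⟨z, hz⟩ := C.map_bijective.2
      ⟨fun i => (((C.map x₀).1 i).1, c i), (C.map x₀).2.1, Set.mem_univ _⟩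
    refine ⟨z, fun i => (hf (toPath z i)).trans ?_⟩
    exact congrArg Prod.snd (congrFun (congrArg Subtype.val hz) i)
  · rintro rfl
    have := (finite_orbitShift C.τ_injective).to_subtype
    have : Finite (markovShift M).Pt := by
      refine Finite.of_injective (fun x => (⟨_, (C.map x).2.1⟩ : (orbitShift C.τ).Pt))
        fun x y h => C.map_bijective.1 (Subtype.ext (funext fun i => ?_))
      exact Prod.ext (congrFun (congrArg Subtype.val h) i) (Subsingleton.elim _ _)
    exact ShiftSpace.entropy_eq_zero_of_finite _

end Uniform

/-! ### The operation of the finite factor -/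

/-- The operation on the orbits of `τ` which is induced by an operation of the alphabet. -/
def orbitOp {m : ℕ} {τ : Fin m → Fin m} {opF : Fin m → Fin m → Fin m}
    (h : ∀ φ ψ, opF (τ φ) (τ ψ) = τ (opF φ ψ)) (φ ψ : (orbitShift τ).Pt) : (orbitShift τ).Pt :=
  ⟨fun i => opF (φ.1 i) (ψ.1 i), fun i => by
    beta_reduce
    rw [φ.2 i, ψ.2 i, h]⟩

lemma isQuasigroup_orbitOp {m : ℕ} {τ : Fin m → Fin m} {opF : Fin m → Fin m → Fin m}
    (h : ∀ φ ψ, opF (τ φ) (τ ψ) = τ (opF φ ψ)) (hl : ∀ φ, Function.Injective (opF φ))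
    (hr : ∀ ψ, Function.Injective fun φ => opF φ ψ) : IsQuasigroup (orbitOp h) :=
  ⟨fun a _ _ => ⟨fun H => Subtype.ext (funext fun i =>
      hl (a.1 i) (congrFun (congrArg Subtype.val H) i)), fun H => H ▸ rfl⟩,
    fun a _ _ => ⟨fun H => Subtype.ext (funext fun i =>
      hr (a.1 i) (congrFun (congrArg Subtype.val H) i)), fun H => H ▸ rfl⟩⟩

namespace PathCode

variable {E : Type*} {op : E → E → E} {T : E → E → Prop} {m n : ℕ}

lemma opF_τ (hT : IsQuasigroupGraph op T) (C : PathCode op T m n) (φ ψ : Fin m) :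
    C.opF (C.τ φ) (C.τ ψ) = C.τ (C.opF φ ψ) := by
  obtain ⟨a, rfl⟩ := C.g_surjective φ
  obtain ⟨b, rfl⟩ := C.g_surjective ψ
  obtain ⟨a', ha⟩ := hT.exists_succ a
  obtain ⟨b', hb⟩ := hT.exists_succ b
  rw [← C.g_succ ha, ← C.g_succ hb, ← C.g_op, ← C.g_op, C.g_succ (hT.compat ha hb)]

variable [Finite E]

lemma opF_injective_left (hT : IsQuasigroupGraph op T) (C : PathCode op T m n) (φ : Fin m) :
    Function.Injective (C.opF φ) := by
  refine Finite.injective_iff_surjective.2 fun ψ => ?_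
  obtain ⟨a, rfl⟩ := C.g_surjective φ
  obtain ⟨b, rfl⟩ := C.g_surjective ψ
  obtain ⟨c, rfl⟩ := hT.exists_op_left a b
  exact ⟨C.g c, (C.g_op a c).symm⟩

lemma opF_injective_right (hT : IsQuasigroupGraph op T) (C : PathCode op T m n) (ψ : Fin m) :
    Function.Injective fun φ => C.opF φ ψ := by
  refine Finite.injective_iff_surjective.2 fun φ => ?_
  obtain ⟨a, rfl⟩ := C.g_surjective φ
  obtain ⟨b, rfl⟩ := C.g_surjective ψ
  obtain ⟨c, rfl⟩ := hT.exists_op_right b a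
  exact ⟨C.g c, (C.g_op c b).symm⟩

end PathCode

end QuasigroupShift

/-! ### Assembly of the main theorem -/

open QuasigroupShift in
theorem mainTheorem1 {A : Type u} [Fintype A] [UniformSpace A] [DiscreteUniformity A]
    (M : Matrix A A ℕ) (hM : ∀ a b, M a b = 0 ∨ M a b = 1)
    (hne : (QuasigroupShift.markovShift M).carrier.Nonempty)
    (op : (QuasigroupShift.markovShift M).Pt → (QuasigroupShift.markovShift M).Pt →
      (QuasigroupShift.markovShift M).Pt)
    (hq : QuasigroupShift.IsQuasigroup op) (hop : QuasigroupShift.IsOneBlockOp op) :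
    ∃ (m n : ℕ) (F : QuasigroupShift.ShiftSpace (Fin m)) (opF : F.Pt → F.Pt → F.Pt)
      (opP : (F.prod (QuasigroupShift.fullShift n)).Pt →
        (F.prod (QuasigroupShift.fullShift n)).Pt →
        (F.prod (QuasigroupShift.fullShift n)).Pt)
      (ζ : (QuasigroupShift.markovShift M).Pt ≃ₜ (F.prod (QuasigroupShift.fullShift n)).Pt),
      -- `F` is a finite quasigroup shift with a 1-block operation
      F.carrier.Finite ∧ QuasigroupShift.IsQuasigroup opF ∧ QuasigroupShift.IsOneBlockOp opF ∧
      -- the operation of the product is a `k`-block quasigroup operation over that of `F`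
      QuasigroupShift.IsQuasigroup opP ∧
      (∃ k : ℕ, 1 ≤ k ∧ QuasigroupShift.IsBlockOp (k - 1) 0 opP) ∧
      (∀ z w, QuasigroupShift.ShiftSpace.fst (opP z w) =
        opF (QuasigroupShift.ShiftSpace.fst z) (QuasigroupShift.ShiftSpace.fst w)) ∧
      -- `ζ` is an isomorphism and a 1-block code
      QuasigroupShift.IsIsomorphism op opP ζ ∧ QuasigroupShift.IsOneBlockCode ζ ∧
      -- zero entropy exactly when the full shift is trivial
      ((QuasigroupShift.markovShift M).entropy = 0 ↔
        ∃ a : Fin n, (QuasigroupShift.fullShift n).carrier = {fun _ => a}) ∧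
      -- irreducible with a constant sequence exactly when `F` is trivial
      ((QuasigroupShift.markovShift M).IsIrreducible ∧
          (QuasigroupShift.markovShift M).HasConstantSequence ↔
        ∃ e : ℤ → Fin m, F.carrier = {e}) := by
  obtain ⟨opL, hG, hL⟩ := exists_isQuasigroupGraph hq hop
  obtain ⟨m, n, ⟨C⟩⟩ := hG.exists_pathCode
  have hA : Nonempty A := ⟨hne.some 0⟩
  obtain ⟨D, hD⟩ := C.exists_symm_rule
  obtain ⟨f, hf⟩ := C.isOneBlockCode hne
  obtain ⟨ρ, hρ⟩ := hop
  have hr : ∀ x y i, (op x y).1 i = ρ (fun _ => x.1 i) (fun _ => y.1 i) := by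
    intro x y i
    rw [hρ]
    congr 1 <;> · funext k; simp [window]
  refine ⟨m, n, orbitShift C.τ, orbitOp (C.opF_τ hG),
    fun z w => C.homeomorph (op (C.homeomorph.symm z) (C.homeomorph.symm w)), C.homeomorph,
    finite_orbitShift C.τ_injective,
    isQuasigroup_orbitOp _ (C.opF_injective_left hG) (C.opF_injective_right hG), ?_, ?_, ?_, ?_,
    ⟨fun x => rfl, fun x y => by simp⟩, ⟨f, hf⟩, ?_, ?_⟩
  · exact ⟨fun v w => C.opF (v 0) (w 0), fun x y j => by simp [window, orbitOp]⟩
  · exact ⟨fun a b c => by simp [(hq.1 _ _ _)], fun a b c => by simp [(hq.2 _ _ _)]⟩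
  -- The local rule decodes both windows, multiplies the resulting letters and encodes the product;
  -- only the decoding needs memory.
  · refine ⟨C.K + 1, by omega, fun v w => f (ρ (fun _ => D v) fun _ => D w), fun z w j => ?_⟩
    rw [hf, hr, hD, hD]
    rfl
  · intro z w
    obtain ⟨x, rfl⟩ := C.homeomorph.surjective z
    obtain ⟨y, rfl⟩ := C.homeomorph.surjective w
    refine Subtype.ext (funext fun i => ?_)
    simp only [Homeomorph.symm_apply_apply]
    exact (congrArg C.g (hL x y i)).trans (C.g_op _ _)
  · rw [fullShift_eq_singleton_iff, C.entropy_eq_zero_iff hne]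
  · rw [C.orbitShift_eq_singleton_iff hne, C.irreducible_iff hne]
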